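/- Let $(M,g)$ be a complete Riemannian manifold with distance function $d$ and scalar curvature $R$, and let $C>0$. We say that $R$ has *at most $C$-quadratic decay at infinity with respect to a basepoint $x\in M$* if there is a constant $D_0>0$ such that $R(y) > C/d(x,y)^2$ for every $y\in M$ with $d(x,y)\ge D_0$. **Proposition.** For every integer $n\ge 3$, the $n$-manifold $\mathbb{R}^2\times\mathbb{T}^{n-2}$, where $\mathbb{T}^{n-2}=(\mathbb{R}/\mathbb{Z})^{n-2}$, admits a complete smooth Riemannian metric whose scalar curvature is everywhere positive and has at most $C$-quadratic decay at infinity for every $0<C<\frac{n-1}{n}$, with respect to every basepoint. -/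

import Mathlib

open Set Filter Manifold Bundle
open scoped Topology ContDiff ENNReal

noncomputable section

/-! ### The smooth structure of the torus `(ℝ / ℤ)^ι` -/

namespace TorusManifold

/-- The local parametrization of the torus `(ℝ / ℤ)^ι` by the open cube `∏ i, (a i, a i + 1)`, that
is, the restriction of the quotient map `ℝ^ι → (ℝ / ℤ)^ι` to this cube. -/
def param {ι : Type*} [Fintype ι] (a : ι → ℝ) :
    OpenPartialHomeomorph (EuclideanSpace ℝ ι) (UnitAddTorus ι) :=
  (EuclideanSpace.equiv ι ℝ).toHomeomorph.toOpenPartialHomeomorph ≫ₕ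
    OpenPartialHomeomorph.pi fun i => AddCircle.openPartialHomeomorphCoe (1 : ℝ) (a i)

/-- The lower corner of the unit cube centred at the representative of `z` in `[0, 1)^ι`. -/
def corner {ι : Type*} (z : UnitAddTorus ι) (i : ι) : ℝ :=
  (AddCircle.equivIco (1 : ℝ) 0 (z i) : ℝ) - 1 / 2

theorem mem_param_target {ι : Type*} [Fintype ι] (z : UnitAddTorus ι) :
    z ∈ (param (corner z)).target := by
  have key : ∀ i, z i ≠ ((corner z i : ℝ) : UnitAddCircle) := by
    intro i h
    have h1 : (((AddCircle.equivIco (1 : ℝ) 0 (z i) : ℝ)) : UnitAddCircle) = z i :=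
      (AddCircle.equivIco (1 : ℝ) 0).symm_apply_apply (z i)
    have h2 : (((1 / 2 : ℝ)) : UnitAddCircle) = 0 := by
      have h3 : ((corner z i : ℝ) : UnitAddCircle)
          = ((AddCircle.equivIco (1 : ℝ) 0 (z i) : ℝ) : UnitAddCircle)
            - (((1 / 2 : ℝ)) : UnitAddCircle) := by
        rw [corner, AddCircle.coe_sub]
      rw [h1, ← h] at h3
      have h4 := sub_eq_self.mp h3.symm
      exact h4
    have := (AddCircle.coe_eq_zero_iff_of_mem_Ico (p := (1 : ℝ)) (a := (1 / 2 : ℝ))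
      ⟨by norm_num, by norm_num⟩).mp h2
    norm_num at this
  simp [param, OpenPartialHomeomorph.pi, key]

/-- The standard charts of `(ℝ / ℤ)^ι`: the inverses of the restrictions of the quotient map
`ℝ^ι → (ℝ / ℤ)^ι` to open unit cubes. -/
instance instChartedSpace {ι : Type*} [Fintype ι] :
    ChartedSpace (EuclideanSpace ℝ ι) (UnitAddTorus ι) where
  atlas := {e | ∃ a : ι → ℝ, e = (param a).symm}
  chartAt z := (param (corner z)).symm
  mem_chart_source z := by simpa using mem_param_target z
  chart_mem_atlas z := ⟨corner z, rfl⟩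

/-- Two lifts of the same point of `ℝ / ℤ`, one of which depends continuously on the other, differ
by a locally constant integer. -/
theorem contDiffAt_transition {c t : ℝ} (h : ((t : ℝ) : UnitAddCircle) ≠ (c : UnitAddCircle)) :
    ContDiffAt ℝ ∞ (fun s : ℝ => (AddCircle.equivIco (1 : ℝ) c (s : UnitAddCircle) : ℝ)) t := by
  set f : ℝ → ℝ := fun s => (AddCircle.equivIco (1 : ℝ) c (s : UnitAddCircle) : ℝ) with hf
  have hcont : ContinuousAt (fun s => s - f s) t := by
    refine continuousAt_id.sub ?_
    have h1 := AddCircle.continuousAt_equivIco (1 : ℝ) c h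
    have h2 : ContinuousAt (fun s : ℝ => (s : UnitAddCircle)) t :=
      (AddCircle.continuous_mk' (1 : ℝ)).continuousAt
    exact continuousAt_subtype_val.comp (ContinuousAt.comp (f := fun s : ℝ => (s : UnitAddCircle))
      (g := AddCircle.equivIco (1 : ℝ) c) h1 h2)
  have hint : ∀ s, ∃ m : ℤ, s - f s = m := by
    intro s
    have h1 : ((f s : ℝ) : UnitAddCircle) = (s : UnitAddCircle) :=
      (AddCircle.equivIco (1 : ℝ) c).symm_apply_apply (s : UnitAddCircle)
    have h2 : ((s - f s : ℝ) : UnitAddCircle) = 0 := by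
      rw [AddCircle.coe_sub, h1, sub_self]
    obtain ⟨m, hm⟩ := (AddCircle.coe_eq_zero_iff (1 : ℝ)).mp h2
    exact ⟨m, by simpa using hm.symm⟩
  have hev : ∀ᶠ s in 𝓝 t, s - f s = t - f t := by
    have h1 := hcont.eventually (Metric.ball_mem_nhds (t - f t) one_pos)
    filter_upwards [h1] with s hs
    obtain ⟨m, hm⟩ := hint s
    obtain ⟨m', hm'⟩ := hint t
    rw [hm, hm', Int.dist_cast_real, Int.dist_eq] at hs
    have h2 : |m - m'| < 1 := by exact_mod_cast hs
    have h3 : m = m' := by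
      rw [Int.abs_lt_one_iff] at h2
      omega
    rw [hm, hm', h3]
  have h3 : ContDiffAt ℝ ∞ (fun s : ℝ => s - (t - f t)) t :=
    contDiffAt_id.sub contDiffAt_const
  refine h3.congr_of_eventuallyEq ?_
  filter_upwards [hev] with s hs
  linarith

instance instIsManifold {ι : Type*} [Fintype ι] :
    IsManifold 𝓘(ℝ, EuclideanSpace ℝ ι) ∞ (UnitAddTorus ι) := by
  apply isManifold_of_contDiffOn
  rintro _ _ ⟨a, rfl⟩ ⟨a', rfl⟩ x hx
  apply ContDiffAt.contDiffWithinAt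
  rw [contDiffAt_euclidean]
  intro i
  have hx' : ((x i : ℝ) : UnitAddCircle) ≠ (a' i : UnitAddCircle) := by
    have h1 := hx.1.2
    simp [param, OpenPartialHomeomorph.pi] at h1
    exact h1 i
  have h2 : ContDiffAt ℝ ∞ (fun y : EuclideanSpace ℝ ι => y i) x :=
    (EuclideanSpace.proj (𝕜 := ℝ) i).contDiff.contDiffAt
  exact (contDiffAt_transition hx').comp x h2

end TorusManifold

/-! ### Riemannian metrics: distance, completeness, scalar curvature -/

namespace RiemMetric

/-- The Riemannian distance of the metric `g`: the infimum of the `g`-lengths of the `C^1` paths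
from `x` to `y`. -/
def riemDist {E H M : Type*} [NormedAddCommGroup E] [NormedSpace ℝ E] [TopologicalSpace H]
    {I : ModelWithCorners ℝ E H} [TopologicalSpace M] [ChartedSpace H M] [IsManifold I ∞ M]
    (g : ContMDiffRiemannianMetric I ∞ E (fun x : M => TangentSpace I x)) (x y : M) : ℝ≥0∞ :=
  letI : RiemannianBundle (fun x : M => TangentSpace I x) := ⟨g.toRiemannianMetric⟩
  Manifold.riemannianEDist I x y

/-- The metric `g` is complete: every Cauchy sequence for its Riemannian distance converges. -/
def IsCompleteMetric {E H M : Type*} [NormedAddCommGroup E] [NormedSpace ℝ E] [TopologicalSpace H]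
    {I : ModelWithCorners ℝ E H} [TopologicalSpace M] [ChartedSpace H M] [IsManifold I ∞ M]
    (g : ContMDiffRiemannianMetric I ∞ E (fun x : M => TangentSpace I x)) : Prop :=
  ∀ u : ℕ → M, (∀ ε : ℝ≥0∞, 0 < ε → ∃ N, ∀ k ≥ N, ∀ l ≥ N, riemDist g (u k) (u l) < ε) →
    ∃ x, Tendsto (fun k => riemDist g (u k) x) atTop (𝓝 0)

/-- The matrix `(g_ij)` of the metric, at the point with coordinate vector `y`, in the preferred
chart around `p` of a manifold without boundary; the coordinates on the model vector space are those
of the basis `b`, and `mfderiv … y (b i)` is the `i`-th coordinate vector field. -/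
def coordMatrix {E H M : Type*} [NormedAddCommGroup E] [NormedSpace ℝ E] [TopologicalSpace H]
    {I : ModelWithCorners ℝ E H} [TopologicalSpace M] [ChartedSpace H M] [IsManifold I ∞ M]
    {ι : Type*} (b : Module.Basis ι ℝ E)
    (g : ContMDiffRiemannianMetric I ∞ E (fun x : M => TangentSpace I x)) (p : M) (y : E) :
    Matrix ι ι ℝ :=
  Matrix.of fun i j => g.inner ((extChartAt I p).symm y)
    (mfderiv 𝓘(ℝ, E) I (extChartAt I p).symm y (b i))
    (mfderiv 𝓘(ℝ, E) I (extChartAt I p).symm y (b j))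

/-- The Christoffel symbol
`Γ^k_ij = (1/2) ∑ l, g^kl (∂_i g_jl + ∂_j g_il - ∂_l g_ij)` of the Levi-Civita connection in the
preferred chart around `p`, at the point with coordinate vector `y`. -/
def christoffel {E H M : Type*} [NormedAddCommGroup E] [NormedSpace ℝ E] [TopologicalSpace H]
    {I : ModelWithCorners ℝ E H} [TopologicalSpace M] [ChartedSpace H M] [IsManifold I ∞ M]
    {ι : Type*} [Fintype ι] [DecidableEq ι] (b : Module.Basis ι ℝ E)
    (g : ContMDiffRiemannianMetric I ∞ E (fun x : M => TangentSpace I x)) (p : M)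
    (k i j : ι) (y : E) : ℝ :=
  (1 / 2) * ∑ l, (coordMatrix b g p y)⁻¹ k l *
    (fderiv ℝ (fun y' => coordMatrix b g p y' j l) y (b i)
      + fderiv ℝ (fun y' => coordMatrix b g p y' i l) y (b j)
      - fderiv ℝ (fun y' => coordMatrix b g p y' i j) y (b l))

/-- The Ricci curvature
`R_jk = ∑ i, (∂_i Γ^i_jk - ∂_j Γ^i_ik) + ∑ i l, (Γ^i_il Γ^l_jk - Γ^i_jl Γ^l_ik)` in the preferred
chart around `p`, at the point with coordinate vector `y`. -/
def ricci {E H M : Type*} [NormedAddCommGroup E] [NormedSpace ℝ E] [TopologicalSpace H]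
    {I : ModelWithCorners ℝ E H} [TopologicalSpace M] [ChartedSpace H M] [IsManifold I ∞ M]
    {ι : Type*} [Fintype ι] [DecidableEq ι] (b : Module.Basis ι ℝ E)
    (g : ContMDiffRiemannianMetric I ∞ E (fun x : M => TangentSpace I x)) (p : M)
    (j k : ι) (y : E) : ℝ :=
  ∑ i, (fderiv ℝ (christoffel b g p i j k) y (b i) - fderiv ℝ (christoffel b g p i i k) y (b j))
    + ∑ i, ∑ l, (christoffel b g p i i l y * christoffel b g p l j k y
        - christoffel b g p i j l y * christoffel b g p l i k y)

/-- The scalar curvature `R = ∑ j k, g^jk R_jk` of `g` at the point `p`, computed in the preferred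
chart around `p` in the coordinates of the basis `b` of the model vector space (as usual, the value
is the same in all coordinates). With this sign the round spheres have positive curvature. -/
def scalarCurvature {E H M : Type*} [NormedAddCommGroup E] [NormedSpace ℝ E] [TopologicalSpace H]
    {I : ModelWithCorners ℝ E H} [TopologicalSpace M] [ChartedSpace H M] [IsManifold I ∞ M]
    {ι : Type*} [Fintype ι] [DecidableEq ι] (b : Module.Basis ι ℝ E)
    (g : ContMDiffRiemannianMetric I ∞ E (fun x : M => TangentSpace I x)) (p : M) : ℝ :=
  ∑ j, ∑ k, (coordMatrix b g p (extChartAt I p p))⁻¹ j k * ricci b g p j k (extChartAt I p p)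

/-- The scalar curvature of `g` has at most `C`-quadratic decay at infinity with respect to the
basepoint `x`: for some `D₀ > 0`, it is larger than `C / d(x, y)^2` at every point `y` with
`d(x, y) ≥ D₀`. -/
def AtMostQuadraticDecay {E H M : Type*} [NormedAddCommGroup E] [NormedSpace ℝ E]
    [TopologicalSpace H] {I : ModelWithCorners ℝ E H} [TopologicalSpace M] [ChartedSpace H M]
    [IsManifold I ∞ M] {ι : Type*} [Fintype ι] [DecidableEq ι] (b : Module.Basis ι ℝ E)
    (g : ContMDiffRiemannianMetric I ∞ E (fun x : M => TangentSpace I x)) (C : ℝ) (x : M) : Prop :=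
  ∃ D₀ : ℝ, 0 < D₀ ∧ ∀ y : M, ENNReal.ofReal D₀ ≤ riemDist g x y →
    C / (riemDist g x y).toReal ^ 2 < scalarCurvature b g y

end RiemMetric

/-! ### The manifold `ℝ² × T^(n-2)` -/

/-- A Euclidean space with its identity chart. -/
instance euclideanChartedSpace (k : ℕ) :
    ChartedSpace (EuclideanSpace ℝ (Fin k)) (EuclideanSpace ℝ (Fin k)) :=
  chartedSpaceSelf _

/-- The product manifold `ℝ² × T^(n-2)`, of dimension `n` when `2 ≤ n`. -/
abbrev PlaneTorus (n : ℕ) : Type :=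
  EuclideanSpace ℝ (Fin 2) × UnitAddTorus (Fin (n - 2))

/-- The model with corners of the product manifold `ℝ² × T^(n-2)`. -/
abbrev planeTorusModel (n : ℕ) :=
  (𝓡 2).prod (𝓡 (n - 2))

/-- The standard basis of the model vector space `ℝ² × ℝ^(n-2)`. -/
def planeTorusBasis (n : ℕ) : Module.Basis (Fin 2 ⊕ Fin (n - 2)) ℝ
    (EuclideanSpace ℝ (Fin 2) × EuclideanSpace ℝ (Fin (n - 2))) :=
  (EuclideanSpace.basisFun (Fin 2) ℝ).toBasis.prod
    (EuclideanSpace.basisFun (Fin (n - 2)) ℝ).toBasis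

end

/-!
# A complete metric of positive scalar curvature on `ℝ² × T^(n-2)`

Away from a compact set, a metric `dr² + r^(2a) (dθ² + |dt|²)` has scalar curvature
`(2 (n - 1) a - n (n - 1) a²) / r²`, and `a = 1 / n` gives the largest constant, `(n - 1) / n`. This
metric is conformal to a flat cylinder times a flat torus. To close it up smoothly at the origin of
the plane, the cylinder is replaced by the cigar `|dx|² / (1 + |x|²)`, which has positive curvature
and a cylindrical end. With `s = |x|²` and `P = 3 + log (1 + s)`, which is about twice the distance
to the origin in the cigar, the metric is
`g = P^(2 / (n - 1)) (|dx|² / (1 + |x|²) + |dt|²)` (`cigarMetric`), and its scalar curvature is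
`4 P^(-2 / (n - 1)) / (1 + s) * (1 - 2 / P + n / (n - 1) * s / P²)`, which is positive
since `P ≥ 3` (`scalarCurvature_cigarMetric`). It follows from the formula for the scalar curvature
of a metric `exp (2 u) |dx|² + exp (2 v) |dt|²` with `u` and `v` functions on the plane, which comes
out of the Christoffel symbols (`RiemMetric.scalarCurvature_of_diagonal`). The changes of charts of
`ℝ² × T^(n-2)` are locally translations, so that the metric has this form in all charts.

The distance of `g` enters through the function `ψ = (n - 1) / (2 n) * P^(n / (n - 1))`
(`distanceProfile`). It is `1`-Lipschitz for `g`, as its gradient has norm at most one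
(`enorm_sub_le_riemDist_cigarMetric`). Its sublevel sets are compact, so `g` is complete
(`RiemMetric.isCompleteMetric_of_isCompact_sublevel`). The scalar curvature at `y` exceeds
`(n - 1) / n * s / (1 + s) / ψ(y)²`, while `d(x, y) ≥ ψ(y) - ψ(x)`. Since compact sets are bounded,
points `y` far from `x` have large `s`, hence large `ψ`; then `C / (ψ(y) - ψ(x))²` is below the
former bound as soon as `C < (n - 1) / n` (`eventually_div_sq_lt`).
-/

/-! ### Riemannian distance -/

namespace RiemMetric

open MeasureTheory in
/-- A `C^1` function whose differential has norm at most one for `g` is `1`-Lipschitz for the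
Riemannian distance of `g`: along a path, the function varies by at most the length of the path. -/
theorem enorm_sub_le_riemDist {E H M : Type*} [NormedAddCommGroup E] [NormedSpace ℝ E]
    [TopologicalSpace H] {I : ModelWithCorners ℝ E H} [TopologicalSpace M] [ChartedSpace H M]
    [IsManifold I ∞ M] (g : ContMDiffRiemannianMetric I ∞ E (fun x : M => TangentSpace I x))
    {ψ : M → ℝ} (hψ : ContMDiff I 𝓘(ℝ, ℝ) 1 ψ)
    (h : ∀ p, ∃ D : E →L[ℝ] ℝ, HasMFDerivAt I 𝓘(ℝ, ℝ) ψ p D ∧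
      ∀ v : TangentSpace I p, D v ^ 2 ≤ g.inner p v v) (x y : M) :
    ‖ψ y - ψ x‖ₑ ≤ riemDist g x y := by
  let : RiemannianBundle (fun x : M => TangentSpace I x) := ⟨g.toRiemannianMetric⟩
  change _ ≤ Manifold.riemannianEDist I x y
  refine le_of_forall_gt fun r hr => ?_
  obtain ⟨γ, rfl, rfl, hγ, hlen⟩ := exists_lt_of_riemannianEDist_lt hr
  refine lt_of_le_of_lt ?_ hlen
  have hD : ContDiffOn ℝ 1 (ψ ∘ γ) (Icc 0 1) :=
    contMDiffOn_iff_contDiffOn.mp (hψ.comp_contMDiffOn hγ)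
  refine (enorm_sub_le_lintegral_derivWithin_Icc_of_contDiffOn_Icc hD zero_le_one).trans ?_
  rw [pathELength_eq_lintegral_mfderivWithin_Icc]
  refine setLIntegral_mono' measurableSet_Icc fun t ht => ?_
  obtain ⟨D, hDt, hDle⟩ := h (γ t)
  have hγt := (hγ.mdifferentiableOn one_ne_zero t ht).hasMFDerivWithinAt
  let L : ℝ →L[ℝ] E := mfderivWithin 𝓘(ℝ, ℝ) I γ (Icc 0 1) t
  have hcomp : HasFDerivWithinAt (ψ ∘ γ) (D.comp L) (Icc 0 1) t :=
    (HasMFDerivAt.comp_hasMFDerivWithinAt t hDt hγt).hasFDerivWithinAt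
  have hder : derivWithin (ψ ∘ γ) (Icc 0 1) t
      = D (mfderivWithin 𝓘(ℝ, ℝ) I γ (Icc 0 1) t (1 : ℝ)) :=
    hcomp.hasDerivWithinAt.derivWithin (uniqueDiffOn_Icc zero_lt_one t ht)
  set w : TangentSpace I (γ t) := mfderivWithin 𝓘(ℝ, ℝ) I γ (Icc 0 1) t (1 : ℝ) with hw
  have hn : ‖w‖ ^ 2 = g.inner (γ t) w w := (real_inner_self_eq_norm_sq w).symm
  rw [hder]
  have : ‖D w‖ ≤ ‖w‖ := by
    rw [Real.norm_eq_abs]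
    exact abs_le_of_sq_le_sq ((hDle w).trans hn.ge) (norm_nonneg w)
  change ‖D w‖ₑ ≤ ‖w‖ₑ
  rw [← ofReal_norm, ← ofReal_norm]
  exact ENNReal.ofReal_le_ofReal this

section

variable {E H M : Type*} [NormedAddCommGroup E] [NormedSpace ℝ E]
    [TopologicalSpace H] {I : ModelWithCorners ℝ E H} [TopologicalSpace M] [ChartedSpace H M]
    [IsManifold I ∞ M] (g : ContMDiffRiemannianMetric I ∞ E (fun x : M => TangentSpace I x))

theorem riemDist_comm (x y : M) : riemDist g x y = riemDist g y x := by
  let : RiemannianBundle (fun x : M => TangentSpace I x) := ⟨g.toRiemannianMetric⟩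
  exact riemannianEDist_comm

theorem riemDist_self (x : M) : riemDist g x x = 0 := by
  let : RiemannianBundle (fun x : M => TangentSpace I x) := ⟨g.toRiemannianMetric⟩
  exact riemannianEDist_self

theorem riemDist_triangle (x y z : M) : riemDist g x z ≤ riemDist g x y + riemDist g y z := by
  let : RiemannianBundle (fun x : M => TangentSpace I x) := ⟨g.toRiemannianMetric⟩
  exact riemannianEDist_triangle

theorem eventually_riemDist_lt (x : M) {c : ℝ≥0∞} (hc : 0 < c) :
    ∀ᶠ y in 𝓝 x, riemDist g x y < c := by
  let : RiemannianBundle (fun x : M => TangentSpace I x) := ⟨g.toRiemannianMetric⟩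
  have : IsContinuousRiemannianBundle E (fun x : M => TangentSpace I x) :=
    ⟨g.inner, g.contMDiff.continuous, fun _ _ _ => rfl⟩
  exact eventually_riemannianEDist_lt I x hc

theorem isOpen_riemDist_lt_top (x : M) : IsOpen {y | riemDist g x y < ⊤} := by
  rw [isOpen_iff_mem_nhds]
  intro y hy
  filter_upwards [eventually_riemDist_lt g y zero_lt_one] with z hz
  exact (riemDist_triangle g x y z).trans_lt (ENNReal.add_lt_top.2 ⟨hy, hz.trans ENNReal.one_lt_top⟩)

/-- On a connected manifold, any two points are at finite Riemannian distance: the points at finite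
distance from a given one form a set that is both open and closed. -/
theorem riemDist_lt_top [ConnectedSpace M] (x y : M) : riemDist g x y < ⊤ := by
  have hclosed : IsClosed {y | riemDist g x y < ⊤} := by
    rw [← isOpen_compl_iff, isOpen_iff_mem_nhds]
    intro y hy
    filter_upwards [eventually_riemDist_lt g y zero_lt_one] with z hz hz'
    refine hy ((riemDist_triangle g x z y).trans_lt (ENNReal.add_lt_top.2 ⟨hz', ?_⟩))
    rw [riemDist_comm]
    exact hz.trans ENNReal.one_lt_top
  have huniv := IsClopen.eq_univ ⟨hclosed, isOpen_riemDist_lt_top g x⟩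
    ⟨x, by simp [riemDist_self]⟩
  exact huniv.ge (mem_univ y)

/-- Compact sets are bounded for the Riemannian distance. -/
theorem exists_riemDist_lt_of_isCompact [ConnectedSpace M] (x : M) {K : Set M}
    (hK : IsCompact K) : ∃ D : ℝ, 0 < D ∧ ∀ y ∈ K, riemDist g x y < ENNReal.ofReal D := by
  refine hK.induction_on
    (p := fun K => ∃ D : ℝ, 0 < D ∧ ∀ y ∈ K, riemDist g x y < ENNReal.ofReal D)
    ⟨1, one_pos, by simp⟩ ?_ ?_ ?_
  · rintro s t hst ⟨D, hD, h⟩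
    exact ⟨D, hD, fun y hy => h y (hst hy)⟩
  · rintro s t ⟨D, hD, h⟩ ⟨D', hD', h'⟩
    refine ⟨max D D', lt_max_of_lt_left hD, ?_⟩
    rintro y (hy | hy)
    · exact (h y hy).trans_le (ENNReal.ofReal_le_ofReal (le_max_left _ _))
    · exact (h' y hy).trans_le (ENNReal.ofReal_le_ofReal (le_max_right _ _))
  · intro z _
    refine ⟨{y | riemDist g z y < 1},
      mem_nhdsWithin_of_mem_nhds (eventually_riemDist_lt g z zero_lt_one),
      (riemDist g x z).toReal + 1, by positivity, fun y hy => ?_⟩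
    rw [ENNReal.ofReal_add ENNReal.toReal_nonneg zero_le_one,
      ENNReal.ofReal_toReal (riemDist_lt_top g x z).ne, ENNReal.ofReal_one]
    exact (riemDist_triangle g x z y).trans_lt
      (ENNReal.add_lt_add_left (riemDist_lt_top g x z).ne hy)

/-- A metric is complete as soon as there is a `1`-Lipschitz function with compact sublevel sets:
Cauchy sequences are bounded, hence stay in a compact set. -/
theorem isCompleteMetric_of_isCompact_sublevel {ψ : M → ℝ}
    (hψ : ∀ x y, ‖ψ y - ψ x‖ₑ ≤ riemDist g x y) (hK : ∀ B : ℝ, IsCompact {p | ψ p ≤ B}) :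
    IsCompleteMetric g := by
  intro u hu
  obtain ⟨N, hN⟩ := hu 1 zero_lt_one
  have hmem : ∀ᶠ k in atTop, u k ∈ {p | ψ p ≤ ψ (u N) + 1} := by
    filter_upwards [eventually_ge_atTop N] with k hk
    have h1 : ‖ψ (u k) - ψ (u N)‖ₑ < 1 := (hψ (u N) (u k)).trans_lt (hN N le_rfl k hk)
    rw [← ofReal_norm, ENNReal.ofReal_lt_one, Real.norm_eq_abs] at h1
    have := (abs_lt.1 h1).2
    change ψ (u k) ≤ _
    linarith
  obtain ⟨x, -, hx⟩ := (hK (ψ (u N) + 1)).exists_mapClusterPt_of_frequently hmem.frequently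
  refine ⟨x, ENNReal.tendsto_nhds_zero.2 fun ε hε => ?_⟩
  have hε2 : 0 < ε / 2 := ENNReal.half_pos hε.ne'
  obtain ⟨N', hN'⟩ := hu (ε / 2) hε2
  obtain ⟨l, hl, hlx⟩ := ((hx.frequently (eventually_riemDist_lt g x hε2)).and_eventually
    (eventually_ge_atTop N')).exists
  filter_upwards [eventually_ge_atTop N'] with k hk
  calc riemDist g (u k) x ≤ riemDist g (u k) (u l) + riemDist g (u l) x := riemDist_triangle ..
    _ ≤ ε / 2 + ε / 2 := by
      rw [riemDist_comm g (u l) x]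
      exact add_le_add (hN' k hk l hlx).le hl.le
    _ = ε := ENNReal.add_halves ε

end

end RiemMetric

/-! ### Scalar curvature of diagonal metrics -/

namespace RiemMetric

section

variable {E H M : Type*} [NormedAddCommGroup E] [NormedSpace ℝ E]
    [TopologicalSpace H] {I : ModelWithCorners ℝ E H} [TopologicalSpace M] [ChartedSpace H M]
    [IsManifold I ∞ M]

theorem inv_diagonal_exp {κ : Type*} [Fintype κ] [DecidableEq κ] (w : κ → ℝ) :
    (Matrix.diagonal fun i => Real.exp (2 * w i))⁻¹
      = Matrix.diagonal fun i => Real.exp (-(2 * w i)) := by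
  refine Matrix.inv_eq_left_inv ?_
  rw [Matrix.diagonal_mul_diagonal, ← Matrix.diagonal_one]
  congr 1
  ext i
  rw [← Real.exp_add]
  simp

/-- The Christoffel symbols of a metric `∑ i, exp (2 w_i) (dx^i)^2` that is diagonal in some
coordinates. -/
theorem christoffel_of_diagonal {κ : Type*} [Fintype κ] [DecidableEq κ] {b : Module.Basis κ ℝ E}
    {g : ContMDiffRiemannianMetric I ∞ E (fun x : M => TangentSpace I x)} {p : M} {y : E}
    {w : κ → E → ℝ} (hw : ∀ i, DifferentiableAt ℝ (w i) y)
    (hg : ∀ᶠ z in 𝓝 y, coordMatrix b g p z = Matrix.diagonal fun i => Real.exp (2 * w i z))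
    (k i j : κ) :
    christoffel b g p k i j y = (if j = k then fderiv ℝ (w k) y (b i) else 0)
      + (if i = k then fderiv ℝ (w k) y (b j) else 0)
      - (if i = j then Real.exp (2 * (w i y - w k y)) * fderiv ℝ (w i) y (b k) else 0) := by
  have hd : ∀ i j, fderiv ℝ (fun z => coordMatrix b g p z i j) y
      = if i = j then (2 * Real.exp (2 * w i y)) • fderiv ℝ (w i) y else 0 := by
    intro i j
    have h1 : (fun z => coordMatrix b g p z i j)
        =ᶠ[𝓝 y] fun z => if i = j then Real.exp (2 * w i z) else 0 := by
      filter_upwards [hg] with z hz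
      rw [hz, Matrix.diagonal_apply]
    rw [h1.fderiv_eq]
    split_ifs with h
    · have := (((hw i).hasFDerivAt.const_mul 2).exp).fderiv
      rw [this, smul_smul, mul_comm]
    · simp
  have hinv : (coordMatrix b g p y)⁻¹ = Matrix.diagonal fun i => Real.exp (-(2 * w i y)) := by
    rw [hg.self_of_nhds, inv_diagonal_exp]
  have hexp : Real.exp (2 * (w i y - w k y))
      = Real.exp (2 * w i y) * Real.exp (-(2 * w k y)) := by
    rw [← Real.exp_add]; ring_nf
  have hone : Real.exp (2 * w k y) * Real.exp (-(2 * w k y)) = 1 := by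
    rw [← Real.exp_add]; simp
  rw [christoffel, hinv, hexp]
  simp only [Matrix.diagonal_apply, hd, ite_mul, zero_mul, Finset.sum_ite_eq, Finset.mem_univ,
    if_true]
  have e1 : (if j = k then (2 * Real.exp (2 * w j y)) • fderiv ℝ (w j) y else 0) (b i)
      = 2 * Real.exp (2 * w k y) * if j = k then fderiv ℝ (w k) y (b i) else 0 := by
    split_ifs with h
    · subst h; simp
    · simp
  have e2 : (if i = k then (2 * Real.exp (2 * w i y)) • fderiv ℝ (w i) y else 0) (b j)
      = 2 * Real.exp (2 * w k y) * if i = k then fderiv ℝ (w k) y (b j) else 0 := by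
    split_ifs with h
    · subst h; simp
    · simp
  have e3 : (if i = j then (2 * Real.exp (2 * w i y)) • fderiv ℝ (w i) y else 0) (b k)
      = 2 * if i = j then Real.exp (2 * w i y) * fderiv ℝ (w i) y (b k) else 0 := by
    split_ifs with h
    · simp [mul_assoc]
    · simp
  rw [e1, e2, e3]
  have e4 : (if i = j then Real.exp (2 * w i y) * Real.exp (-(2 * w k y)) * fderiv ℝ (w i) y (b k)
      else 0) = Real.exp (-(2 * w k y)) *
        if i = j then Real.exp (2 * w i y) * fderiv ℝ (w i) y (b k) else 0 := by
    split_ifs with h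
    · ring
    · simp
  rw [e4]
  linear_combination ((if j = k then fderiv ℝ (w k) y (b i) else 0)
    + if i = k then fderiv ℝ (w k) y (b j) else 0) * hone

/-- The scalar curvature of a metric of the form
`exp (2 u) (dx_0^2 + dx_1^2) + exp (2 v) ∑ μ, (dt_μ)^2`, with `m` coordinates `t_μ`, where `u` and
`v` do not depend on the `t_μ`. -/
theorem scalarCurvature_of_diagonal {τ : Type*} [Fintype τ] [DecidableEq τ]
    {b : Module.Basis (Fin 2 ⊕ τ) ℝ E}
    {g : ContMDiffRiemannianMetric I ∞ E (fun x : M => TangentSpace I x)} {p : M}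
    {u v : E → ℝ} (hu : ContDiff ℝ 2 u) (hv : ContDiff ℝ 2 v)
    (hu0 : ∀ y μ, fderiv ℝ u y (b (Sum.inr μ)) = 0) (hv0 : ∀ y μ, fderiv ℝ v y (b (Sum.inr μ)) = 0)
    (hg : ∀ᶠ z in 𝓝 (extChartAt I p p), coordMatrix b g p z
      = Matrix.diagonal fun i => Real.exp (2 * Sum.elim (fun _ => u z) (fun _ => v z) i))
    (u₁ u₂ v₁ v₂ : Fin 2 → ℝ)
    (hu₁ : ∀ a, fderiv ℝ u (extChartAt I p p) (b (Sum.inl a)) = u₁ a)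
    (hv₁ : ∀ a, fderiv ℝ v (extChartAt I p p) (b (Sum.inl a)) = v₁ a)
    (hu₂ : ∀ a, fderiv ℝ (fun y => fderiv ℝ u y (b (Sum.inl a))) (extChartAt I p p)
      (b (Sum.inl a)) = u₂ a)
    (hv₂ : ∀ a, fderiv ℝ (fun y => fderiv ℝ v y (b (Sum.inl a))) (extChartAt I p p)
      (b (Sum.inl a)) = v₂ a) :
    scalarCurvature b g p = -Real.exp (-(2 * u (extChartAt I p p))) *
      (2 * ∑ a, u₂ a + 2 * Fintype.card τ * ∑ a, v₂ a
        + Fintype.card τ * (Fintype.card τ + 1) * ∑ a, v₁ a ^ 2) := by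
  set y₀ := extChartAt I p p with hy₀
  have hdu : ∀ y, DifferentiableAt ℝ u y := fun y => (hu.differentiable two_ne_zero) y
  have hdv : ∀ y, DifferentiableAt ℝ v y := fun y => (hv.differentiable two_ne_zero) y
  have hddu : ∀ a, DifferentiableAt ℝ (fun y => fderiv ℝ u y (b (Sum.inl a))) y₀ := fun a =>
    (((hu.fderiv_right (m := 1) (by norm_num)).clm_apply contDiff_const).differentiable
      one_ne_zero) y₀
  have hddv : ∀ a, DifferentiableAt ℝ (fun y => fderiv ℝ v y (b (Sum.inl a))) y₀ := fun a =>
    (((hv.fderiv_right (m := 1) (by norm_num)).clm_apply contDiff_const).differentiable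
      one_ne_zero) y₀
  set A : Fin 2 → E → ℝ := fun a y => fderiv ℝ u y (b (Sum.inl a)) with hA
  set B : Fin 2 → E → ℝ := fun a y => fderiv ℝ v y (b (Sum.inl a)) with hB
  have hchr : ∀ᶠ y in 𝓝 y₀, ∀ k i j, christoffel b g p k i j y =
      (if j = k then fderiv ℝ (fun z => Sum.elim (fun _ => u z) (fun _ => v z) k) y (b i) else 0)
      + (if i = k then fderiv ℝ (fun z => Sum.elim (fun _ => u z) (fun _ => v z) k) y (b j) else 0)
      - (if i = j then Real.exp (2 * (Sum.elim (fun _ => u y) (fun _ => v y) i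
        - Sum.elim (fun _ => u y) (fun _ => v y) k))
        * fderiv ℝ (fun z => Sum.elim (fun _ => u z) (fun _ => v z) i) y (b k) else 0) := by
    filter_upwards [hg.eventually_nhds] with y hy k i j
    exact christoffel_of_diagonal (w := fun i z => Sum.elim (fun _ => u z) (fun _ => v z) i)
      (by rintro (i | i); exacts [hdu y, hdv y]) hy k i j
  -- The Christoffel symbols near `y₀`, according to the types of the three indices.
  have c1 : ∀ c a d, christoffel b g p (Sum.inl c) (Sum.inl a) (Sum.inl d) =ᶠ[𝓝 y₀] fun y =>
      (if d = c then A a y else 0) + (if a = c then A d y else 0) - if a = d then A c y else 0 := by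
    intro c a d
    filter_upwards [hchr] with y hy
    simp [hy, hA]
  have c2 : ∀ c μ ν, christoffel b g p (Sum.inl c) (Sum.inr μ) (Sum.inr ν) =ᶠ[𝓝 y₀] fun y =>
      if μ = ν then -(Real.exp (2 * (v y - u y)) * B c y) else 0 := by
    intro c μ ν
    filter_upwards [hchr] with y hy
    by_cases h : μ = ν <;> simp [hy, hB, h]
  have c3 : ∀ μ a ν, christoffel b g p (Sum.inr μ) (Sum.inl a) (Sum.inr ν) =ᶠ[𝓝 y₀] fun y =>
      if μ = ν then B a y else 0 := by
    intro μ a ν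
    filter_upwards [hchr] with y hy
    simp [hy, hB, eq_comm]
  have c4 : ∀ μ ν a, christoffel b g p (Sum.inr μ) (Sum.inr ν) (Sum.inl a) =ᶠ[𝓝 y₀] fun y =>
      if μ = ν then B a y else 0 := by
    intro μ a ν
    filter_upwards [hchr] with y hy
    simp [hy, hB, eq_comm]
  have c5 : ∀ μ a d, christoffel b g p (Sum.inr μ) (Sum.inl a) (Sum.inl d) =ᶠ[𝓝 y₀] fun _ => 0 := by
    intro μ a d
    filter_upwards [hchr] with y hy
    simp [hy, hu0]
  have c6 : ∀ c a μ, christoffel b g p (Sum.inl c) (Sum.inl a) (Sum.inr μ) =ᶠ[𝓝 y₀] fun _ => 0 := by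
    intro c a μ
    filter_upwards [hchr] with y hy
    simp [hy, hu0]
  have c7 : ∀ c μ a, christoffel b g p (Sum.inl c) (Sum.inr μ) (Sum.inl a) =ᶠ[𝓝 y₀] fun _ => 0 := by
    intro c a μ
    filter_upwards [hchr] with y hy
    simp [hy, hu0]
  have c8 : ∀ μ ν σ, christoffel b g p (Sum.inr μ) (Sum.inr ν) (Sum.inr σ) =ᶠ[𝓝 y₀]
      fun _ => 0 := by
    intro c a μ
    filter_upwards [hchr] with y hy
    simp [hy, hv0]
  -- The derivatives at `y₀` of the Christoffel symbols that occur in the diagonal Ricci entries.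
  have d1 : ∀ c a d e, fderiv ℝ (christoffel b g p (Sum.inl c) (Sum.inl a) (Sum.inl d)) y₀ e =
      (if d = c then fderiv ℝ (A a) y₀ e else 0) + (if a = c then fderiv ℝ (A d) y₀ e else 0)
        - if a = d then fderiv ℝ (A c) y₀ e else 0 := by
    have key : ∀ (P : Prop) [Decidable P] (a : Fin 2), HasFDerivAt
        (fun y => if P then A a y else 0) (if P then fderiv ℝ (A a) y₀ else 0) y₀ := by
      intro P _ a
      split_ifs
      · exact (hddu a).hasFDerivAt
      · exact hasFDerivAt_const _ _
    intro c a d e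
    rw [(c1 c a d).fderiv_eq, (((key (d = c) a).fun_add (key (a = c) d)).fun_sub
      (key (a = d) c)).fderiv]
    simp only [sub_apply, add_apply]
    split_ifs <;> simp
  have d2 : ∀ c μ e, fderiv ℝ (christoffel b g p (Sum.inl c) (Sum.inr μ) (Sum.inr μ)) y₀ e =
      -(Real.exp (2 * (v y₀ - u y₀)) * (fderiv ℝ (B c) y₀ e
        + 2 * (fderiv ℝ v y₀ e - fderiv ℝ u y₀ e) * B c y₀)) := by
    intro c μ e
    rw [(c2 c μ μ).fderiv_eq]
    have := ((((hdv y₀).hasFDerivAt.fun_sub (hdu y₀).hasFDerivAt).const_mul 2).exp.fun_mul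
      (hddv c).hasFDerivAt).fun_neg
    simp only [if_true]
    rw [this.fderiv]
    simp [hB]
    ring
  have d3 : ∀ μ a e, fderiv ℝ (christoffel b g p (Sum.inr μ) (Sum.inr μ) (Sum.inl a)) y₀ e =
      fderiv ℝ (B a) y₀ e := by
    intro μ a e
    rw [(c4 μ μ a).fderiv_eq]
    simp
  have d5 : ∀ μ a d e, fderiv ℝ (christoffel b g p (Sum.inr μ) (Sum.inl a) (Sum.inl d)) y₀ e =
      0 := by
    intro μ a d e
    rw [(c5 μ a d).fderiv_eq]
    simp
  have d6 : ∀ c a μ e, fderiv ℝ (christoffel b g p (Sum.inl c) (Sum.inl a) (Sum.inr μ)) y₀ e =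
      0 := by
    intro μ a d e
    rw [(c6 μ a d).fderiv_eq]
    simp
  have d8 : ∀ μ ν σ e, fderiv ℝ (christoffel b g p (Sum.inr μ) (Sum.inr ν) (Sum.inr σ)) y₀ e =
      0 := by
    intro μ a d e
    rw [(c8 μ a d).fderiv_eq]
    simp
  replace c1 := fun c a d => (c1 c a d).eq_of_nhds
  replace c2 := fun c a d => (c2 c a d).eq_of_nhds
  replace c3 := fun c a d => (c3 c a d).eq_of_nhds
  replace c4 := fun c a d => (c4 c a d).eq_of_nhds
  replace c5 := fun c a d => (c5 c a d).eq_of_nhds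
  replace c6 := fun c a d => (c6 c a d).eq_of_nhds
  replace c7 := fun c a d => (c7 c a d).eq_of_nhds
  replace c8 := fun c a d => (c8 c a d).eq_of_nhds
  have hAv : ∀ a, A a y₀ = u₁ a := hu₁
  have hBv : ∀ a, B a y₀ = v₁ a := hv₁
  have hA2 : ∀ a, fderiv ℝ (A a) y₀ (b (Sum.inl a)) = u₂ a := hu₂
  have hB2 : ∀ a, fderiv ℝ (B a) y₀ (b (Sum.inl a)) = v₂ a := hv₂
  -- The two plane entries are added, since the products of derivatives of `u` and `v` cancel only
  -- in their sum.
  have rl : ricci b g p (Sum.inl 0) (Sum.inl 0) y₀ + ricci b g p (Sum.inl 1) (Sum.inl 1) y₀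
      = -(2 * ∑ a, u₂ a + Fintype.card τ * ∑ a, v₂ a + Fintype.card τ * ∑ a, v₁ a ^ 2) := by
    simp [ricci, Fintype.sum_sum_type, Fin.sum_univ_two, c1, c3, c4, c5, c6, c7, d1, d3, d5,
      hAv, hBv, hA2, hB2]
    ring
  have rr : ∀ μ, ricci b g p (Sum.inr μ) (Sum.inr μ) y₀ = -(Real.exp (2 * (v y₀ - u y₀)) *
      (∑ a, v₂ a + Fintype.card τ * ∑ a, v₁ a ^ 2)) := by
    intro μ
    simp [ricci, Fintype.sum_sum_type, Fin.sum_univ_two, c1, c2, c3, c4, c6, c7, c8, d2, d6, d8,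
      hAv, hBv, hB2, hu₁, hv₁, Finset.sum_add_distrib]
    ring
  have hexp : Real.exp (-(2 * u y₀))
      = Real.exp (-(2 * v y₀)) * Real.exp (2 * (v y₀ - u y₀)) := by
    rw [← Real.exp_add]; ring_nf
  rw [scalarCurvature, ← hy₀, hg.self_of_nhds, inv_diagonal_exp]
  simp only [Matrix.diagonal_apply, ite_mul, zero_mul, Finset.sum_ite_eq, Finset.mem_univ,
    if_true, Fintype.sum_sum_type, Sum.elim_inl, Sum.elim_inr, rr, Finset.sum_const,
    Finset.card_univ, nsmul_eq_mul, ← Finset.mul_sum]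
  rw [Fin.sum_univ_two (fun a => ricci b g p (Sum.inl a) (Sum.inl a) y₀), rl, hexp]
  ring

end

end RiemMetric

/-! ### The flat structure of `ℝ² × T^(n-2)` -/

namespace PlaneTorusMetric

/-- The quotient map `ℝ → ℝ / ℤ` is a local isometry: its local inverses have derivative one. -/
theorem hasDerivAt_equivIco {c t : ℝ} (h : ((t : ℝ) : UnitAddCircle) ≠ (c : UnitAddCircle)) :
    HasDerivAt (fun s : ℝ => (AddCircle.equivIco (1 : ℝ) c (s : UnitAddCircle) : ℝ)) 1 t := by
  set f : ℝ → ℝ := fun s => (AddCircle.equivIco (1 : ℝ) c (s : UnitAddCircle) : ℝ) with hf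
  have hint : ∀ s, ∃ m : ℤ, s - f s = m := by
    intro s
    have h1 : ((f s : ℝ) : UnitAddCircle) = (s : UnitAddCircle) :=
      (AddCircle.equivIco (1 : ℝ) c).symm_apply_apply (s : UnitAddCircle)
    have h2 : ((s - f s : ℝ) : UnitAddCircle) = 0 := by
      rw [AddCircle.coe_sub, h1, sub_self]
    obtain ⟨m, hm⟩ := (AddCircle.coe_eq_zero_iff (1 : ℝ)).mp h2
    exact ⟨m, by simpa using hm.symm⟩
  have hcont : ContinuousAt (fun s => s - f s) t :=
    continuousAt_id.sub (TorusManifold.contDiffAt_transition h).continuousAt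
  have hev : f =ᶠ[𝓝 t] fun s => s - (t - f t) := by
    filter_upwards [hcont.eventually (Metric.ball_mem_nhds (t - f t) one_pos)] with s hs
    obtain ⟨m, hm⟩ := hint s
    obtain ⟨m', hm'⟩ := hint t
    rw [hm, hm', Int.dist_cast_real, Int.dist_eq] at hs
    have h2 : |m - m'| < 1 := by exact_mod_cast hs
    rw [Int.abs_lt_one_iff] at h2
    have h3 : m = m' := by omega
    rw [hm', ← h3, ← hm]
    ring
  exact ((hasDerivAt_id t).sub_const (t - f t)).congr_of_eventuallyEq hev

/-- The model vector space `ℝ² × ℝ^(n-2)`. -/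
abbrev Model (n : ℕ) : Type :=
  EuclideanSpace ℝ (Fin 2) × EuclideanSpace ℝ (Fin (n - 2))

/-- The model space of the charts of `ℝ² × T^(n-2)`; it is a copy of `Model n`. -/
abbrev ChartModel (n : ℕ) : Type :=
  ModelProd (EuclideanSpace ℝ (Fin 2)) (EuclideanSpace ℝ (Fin (n - 2)))

/-- The universal covering map `ℝ² × ℝ^(n-2) → ℝ² × T^(n-2)`, which is the inverse of all the
preferred charts. -/
def cover (n : ℕ) (w : Model n) : PlaneTorus n :=
  (w.1, fun i => ((w.2 i : ℝ) : UnitAddCircle))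

variable {n : ℕ}

theorem mem_source_iff (p z : PlaneTorus n) :
    z ∈ (chartAt (ChartModel n) p).source
      ↔ ∀ i, z.2 i ≠ (TorusManifold.corner p.2 i : UnitAddCircle) := by
  simp [TorusManifold.param, OpenPartialHomeomorph.pi, chartAt, ChartedSpace.chartAt]

theorem continuous_cover : Continuous (cover n) := by
  have (i : Fin (n - 2)) : Continuous fun w : Model n => w.2 i := by fun_prop
  exact continuous_fst.prodMk (continuous_pi fun i =>
    (AddCircle.continuous_mk' (1 : ℝ)).comp (this i))

/-- Changes of charts are locally translations. -/
theorem hasFDerivAt_extChartAt_cover (p : PlaneTorus n) (w : Model n)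
    (h : ∀ i, (cover n w).2 i ≠ (TorusManifold.corner p.2 i : UnitAddCircle)) :
    HasFDerivAt (fun w => extChartAt (planeTorusModel n) p (cover n w))
      (ContinuousLinearMap.id ℝ (Model n)) w := by
  have h1 : HasFDerivAt (fun w : Model n => (extChartAt (planeTorusModel n) p (cover n w)).1)
    (ContinuousLinearMap.fst ℝ _ _) w := hasFDerivAt_fst
  have h2 : HasFDerivAt (fun w : Model n => (extChartAt (planeTorusModel n) p (cover n w)).2)
      (ContinuousLinearMap.snd ℝ _ _) w := by
    rw [← hasFDerivWithinAt_univ, hasFDerivWithinAt_euclidean]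
    intro i
    rw [hasFDerivWithinAt_univ]
    let L : Model n →L[ℝ] ℝ := (EuclideanSpace.proj i).comp (ContinuousLinearMap.snd ℝ _ _)
    have h3 : HasFDerivAt (fun w : Model n => w.2 i) L w := L.hasFDerivAt
    have := (hasDerivAt_equivIco (h i)).comp_hasFDerivAt w h3
    rw [one_smul] at this
    exact this
  exact h1.prodMk h2

/-- In the identification of the tangent spaces with the model space through the preferred charts,
the differential of the universal covering map is the identity. -/
theorem hasMFDerivAt_cover (w : Model n) :
    HasMFDerivAt 𝓘(ℝ, Model n) (planeTorusModel n) (cover n) w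
      (ContinuousLinearMap.id ℝ (Model n)) := by
  refine ⟨continuous_cover.continuousAt, HasFDerivAt.hasFDerivWithinAt ?_⟩
  exact hasFDerivAt_extChartAt_cover _ w ((mem_source_iff _ _).1 (mem_chart_source _ _))

theorem tangentCoordChange_eq_id (p q z : PlaneTorus n)
    (hp : z ∈ (chartAt (ChartModel n) p).source) (hq : z ∈ (chartAt (ChartModel n) q).source) :
    tangentCoordChange (planeTorusModel n) p q z = ContinuousLinearMap.id ℝ (Model n) := by
  have hz : cover n (extChartAt (planeTorusModel n) p z) = z :=
    (extChartAt (planeTorusModel n) p).left_inv (by rwa [extChartAt_source])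
  rw [tangentCoordChange_def, ModelWithCorners.range_eq_univ, fderivWithin_univ]
  refine (hasFDerivAt_extChartAt_cover q (extChartAt (planeTorusModel n) p z) ?_).fderiv
  rw [hz]
  exact (mem_source_iff _ _).1 hq

end PlaneTorusMetric

/-! ### Torus-invariant diagonal metrics on `ℝ² × T^(n-2)` -/

namespace PlaneTorusMetric

variable {n : ℕ}

/-- The inner product `a ⟨v.1, w.1⟩ + b ⟨v.2, w.2⟩` on `ℝ² × ℝ^(n-2)`, as a bilinear form. -/
noncomputable def blockForm (n : ℕ) (a b : ℝ) : Model n →L[ℝ] Model n →L[ℝ] ℝ :=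
  a • (innerSL ℝ).bilinearComp (ContinuousLinearMap.fst ℝ _ _) (ContinuousLinearMap.fst ℝ _ _)
    + b • (innerSL ℝ).bilinearComp (ContinuousLinearMap.snd ℝ _ _) (ContinuousLinearMap.snd ℝ _ _)

theorem blockForm_apply (a b : ℝ) (v w : Model n) :
    blockForm n a b v w = a * inner ℝ v.1 w.1 + b * inner ℝ v.2 w.2 := by
  simp [blockForm]

theorem blockForm_symm (a b : ℝ) (v w : Model n) :
    blockForm n a b v w = blockForm n a b w v := by
  rw [blockForm_apply, blockForm_apply, real_inner_comm, real_inner_comm w.2]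

theorem blockForm_pos {a b : ℝ} (ha : 0 < a) (hb : 0 < b) (v : Model n) (hv : v ≠ 0) :
    0 < blockForm n a b v v := by
  rw [blockForm_apply, real_inner_self_eq_norm_sq, real_inner_self_eq_norm_sq]
  by_cases h : v.1 = 0
  · have h2 : v.2 ≠ 0 := fun h2 => hv (Prod.ext h h2)
    have := norm_pos_iff.2 h2
    positivity
  · have := norm_pos_iff.2 h
    positivity

theorem isBounded_blockForm_lt_one {a b : ℝ} (ha : 0 < a) (hb : 0 < b) :
    Bornology.IsBounded {v : Model n | blockForm n a b v v < 1} := by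
  rw [isBounded_iff_forall_norm_le]
  refine ⟨max (1 / √a) (1 / √b), fun v hv => ?_⟩
  change blockForm n a b v v < 1 at hv
  rw [blockForm_apply, real_inner_self_eq_norm_sq, real_inner_self_eq_norm_sq] at hv
  have key : ∀ c r : ℝ, 0 < c → 0 ≤ r → c * r ^ 2 < 1 → r ≤ 1 / √c := by
    intro c r hc hr h
    rw [le_div_iff₀ (Real.sqrt_pos.2 hc)]
    refine abs_le_of_sq_le_sq' ?_ zero_le_one |>.2
    rw [mul_pow, Real.sq_sqrt hc.le]
    linarith
  have h1 : 0 ≤ a * ‖v.1‖ ^ 2 := by positivity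
  have h2 : 0 ≤ b * ‖v.2‖ ^ 2 := by positivity
  rw [Prod.norm_def]
  exact max_le_max (key a _ ha (norm_nonneg _) (by linarith))
    (key b _ hb (norm_nonneg _) (by linarith))

theorem contDiff_blockForm {F : Type*} [NormedAddCommGroup F] [NormedSpace ℝ F] {a b : F → ℝ}
    (ha : ContDiff ℝ ∞ a) (hb : ContDiff ℝ ∞ b) :
    ContDiff ℝ ∞ fun x => blockForm n (a x) (b x) := by
  rw [contDiff_clm_apply_iff]
  intro v
  rw [contDiff_clm_apply_iff]
  intro w
  simp only [blockForm_apply]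
  exact (ha.mul contDiff_const).add (hb.mul contDiff_const)

/-- The trivializations of the tangent bundle given by the preferred charts are the identity. -/
theorem trivializationAt_symm_eq (p q : PlaneTorus n)
    (hq : q ∈ (chartAt (ChartModel n) p).source) (w : Model n) :
    (trivializationAt (Model n) (TangentSpace (planeTorusModel n)) p).symm q w = w := by
  have h1 := TangentBundle.symmL_trivializationAt_eq_core (I := planeTorusModel n)
    (𝕜 := ℝ) hq
  have h2 := tangentCoordChange_eq_id p q q hq (mem_chart_source _ q)
  have h3 := congrArg (fun L : Model n →L[ℝ] Model n => L w) (h1.trans h2)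
  exact (Trivialization.symmL_apply _ (by simpa using hq) w).symm.trans h3

/-- The family of bilinear forms `a |dx|² + b |dt|²`, with coefficients depending smoothly on
`x ∈ ℝ²`, is a smooth section of the bundle of bilinear forms on the tangent spaces. -/
theorem contMDiff_blockForm {a b : EuclideanSpace ℝ (Fin 2) → ℝ} (ha : ContDiff ℝ ∞ a)
    (hb : ContDiff ℝ ∞ b) :
    ContMDiff (planeTorusModel n)
      ((planeTorusModel n).prod 𝓘(ℝ, Model n →L[ℝ] Model n →L[ℝ] ℝ)) ∞
      (fun p : PlaneTorus n => TotalSpace.mk' (Model n →L[ℝ] Model n →L[ℝ] ℝ)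
        (E := fun p : PlaneTorus n => TangentSpace (planeTorusModel n) p →L[ℝ]
          TangentSpace (planeTorusModel n) p →L[ℝ] ℝ) p (blockForm n (a p.1) (b p.1))) := by
  intro p
  rw [contMDiffAt_hom_bundle]
  refine ⟨contMDiffAt_id, ?_⟩
  have hfst : ContMDiff (planeTorusModel n) 𝓘(ℝ, EuclideanSpace ℝ (Fin 2)) ∞
    (Prod.fst : PlaneTorus n → _) := contMDiff_fst
  have hsmooth : ContMDiffAt (planeTorusModel n) 𝓘(ℝ, Model n →L[ℝ] Model n →L[ℝ] ℝ) ∞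
      (fun q : PlaneTorus n => blockForm n (a q.1) (b q.1)) p :=
    ((contDiff_blockForm ha hb).contMDiff.comp hfst) p
  refine hsmooth.congr_of_eventuallyEq ?_
  filter_upwards [chart_source_mem_nhds (ChartModel n) p] with q hq
  refine ContinuousLinearMap.ext fun x => ContinuousLinearMap.ext fun y => ?_
  let φ : TangentSpace (planeTorusModel n) q →L[ℝ] TangentSpace (planeTorusModel n) q →L[ℝ] ℝ :=
    blockForm n (a q.1) (b q.1)
  refine (inCoordinates_apply_eq₂ (F₁ := Model n) (F₂ := Model n) (F₃ := ℝ) (x₀ := p) (ϕ := φ)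
    (E₃ := Bundle.Trivial (PlaneTorus n) ℝ) (v := x) (w := y) (by simpa using hq)
    (by simpa using hq) (by simp)).trans ?_
  rw [trivializationAt_symm_eq p q hq, trivializationAt_symm_eq p q hq]
  simp
  rfl

/-- The metric `exp (2 u) |dx|² + exp (2 v) |dt|²` on `ℝ² × T^(n-2)`, where `u` and `v` are smooth
functions on `ℝ²`. All tangent spaces are identified with the model vector space through the
preferred charts; this identification does not depend on the chart, since the changes of charts are
locally translations. -/
noncomputable def blockMetric (n : ℕ) (u v : EuclideanSpace ℝ (Fin 2) → ℝ) (hu : ContDiff ℝ ∞ u)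
    (hv : ContDiff ℝ ∞ v) :
    ContMDiffRiemannianMetric (planeTorusModel n) ∞ (Model n)
      (fun p : PlaneTorus n => TangentSpace (planeTorusModel n) p) where
  inner p := blockForm n (Real.exp (2 * u p.1)) (Real.exp (2 * v p.1))
  symm _ := blockForm_symm _ _
  pos _ := blockForm_pos (Real.exp_pos _) (Real.exp_pos _)
  isVonNBounded _ := (NormedSpace.isVonNBounded_iff ℝ).2
    (isBounded_blockForm_lt_one (Real.exp_pos _) (Real.exp_pos _))
  contMDiff := contMDiff_blockForm (contDiff_const.mul hu).exp (contDiff_const.mul hv).exp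

theorem blockMetric_inner (u v : EuclideanSpace ℝ (Fin 2) → ℝ) (hu : ContDiff ℝ ∞ u)
    (hv : ContDiff ℝ ∞ v) (p : PlaneTorus n) (x y : Model n) :
    (blockMetric n u v hu hv).inner p x y
      = Real.exp (2 * u p.1) * inner ℝ x.1 y.1 + Real.exp (2 * v p.1) * inner ℝ x.2 y.2 :=
  blockForm_apply _ _ x y

/-- In all the preferred charts, the matrix of the metric is diagonal. The formula even holds outside
the target of the chart, since the inverse of the chart is defined as the covering map there. -/
theorem coordMatrix_blockMetric (u v : EuclideanSpace ℝ (Fin 2) → ℝ) (hu : ContDiff ℝ ∞ u)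
    (hv : ContDiff ℝ ∞ v) (p : PlaneTorus n) (w : Model n) :
    RiemMetric.coordMatrix (planeTorusBasis n) (blockMetric n u v hu hv) p w
      = Matrix.diagonal fun i =>
        Real.exp (2 * Sum.elim (fun _ => u w.1) (fun _ => v w.1) i) := by
  have hD : mfderiv 𝓘(ℝ, Model n) (planeTorusModel n) (extChartAt (planeTorusModel n) p).symm w
      = ContinuousLinearMap.id ℝ (Model n) := (hasMFDerivAt_cover w).mfderiv
  ext i j
  simp only [RiemMetric.coordMatrix, Matrix.of_apply, hD]
  refine (blockMetric_inner u v hu hv (cover n w) (planeTorusBasis n i)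
    (planeTorusBasis n j)).trans ?_
  have h1 : (cover n w).1 = w.1 := rfl
  rw [h1, Matrix.diagonal_apply]
  rcases i with i | i <;> rcases j with j | j <;>
    simp [planeTorusBasis, EuclideanSpace.inner_single_left, eq_comm]

end PlaneTorusMetric

/-! ### Radial functions on the plane -/

namespace PlaneTorusMetric

variable {n : ℕ}

theorem planeTorusBasis_inl (a : Fin 2) :
    planeTorusBasis n (Sum.inl a) = (EuclideanSpace.single a 1, 0) := by
  simp [planeTorusBasis]

theorem planeTorusBasis_inr (μ : Fin (n - 2)) :
    planeTorusBasis n (Sum.inr μ) = (0, EuclideanSpace.single μ 1) := by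
  simp [planeTorusBasis]

theorem fderiv_radial {φ : ℝ → ℝ} {φ' : ℝ} {w : Model n} (h : HasDerivAt φ φ' (‖w.1‖ ^ 2))
    (e : Model n) :
    fderiv ℝ (fun w : Model n => φ (‖w.1‖ ^ 2)) w e = 2 * inner ℝ w.1 e.1 * φ' := by
  have h1 := h.comp_hasFDerivAt w (hasFDerivAt_fst (𝕜 := ℝ) (p := w)).norm_sq
  have h2 := h1.fderiv
  rw [show (fun w : Model n => φ (‖w.1‖ ^ 2)) = φ ∘ (‖Prod.fst ·‖ ^ 2) from rfl, h2]
  simp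
  ring

theorem fderiv_radial_inl {φ : ℝ → ℝ} {φ' : ℝ} {w : Model n}
    (h : HasDerivAt φ φ' (‖w.1‖ ^ 2)) (a : Fin 2) :
    fderiv ℝ (fun w : Model n => φ (‖w.1‖ ^ 2)) w (planeTorusBasis n (Sum.inl a))
      = 2 * w.1 a * φ' := by
  rw [fderiv_radial h, planeTorusBasis_inl, EuclideanSpace.inner_single_right]
  simp

theorem fderiv_radial_inr {φ : ℝ → ℝ} {φ' : ℝ} {w : Model n}
    (h : HasDerivAt φ φ' (‖w.1‖ ^ 2)) (μ : Fin (n - 2)) :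
    fderiv ℝ (fun w : Model n => φ (‖w.1‖ ^ 2)) w (planeTorusBasis n (Sum.inr μ)) = 0 := by
  rw [fderiv_radial h, planeTorusBasis_inr]
  simp

theorem fderiv_fderiv_radial_inl {φ φ' : ℝ → ℝ} {φ'' : ℝ} {w : Model n}
    (h : ∀ s, 0 ≤ s → HasDerivAt φ (φ' s) s) (h' : HasDerivAt φ' φ'' (‖w.1‖ ^ 2)) (a : Fin 2) :
    fderiv ℝ (fun z : Model n => fderiv ℝ (fun w : Model n => φ (‖w.1‖ ^ 2)) z
        (planeTorusBasis n (Sum.inl a))) w (planeTorusBasis n (Sum.inl a))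
      = 2 * φ' (‖w.1‖ ^ 2) + 4 * w.1 a ^ 2 * φ'' := by
  have h1 : (fun z : Model n => fderiv ℝ (fun w : Model n => φ (‖w.1‖ ^ 2)) z
      (planeTorusBasis n (Sum.inl a))) = fun z => 2 * z.1 a * φ' (‖z.1‖ ^ 2) := by
    ext z
    exact fderiv_radial_inl (h _ (by positivity)) a
  let L : Model n →L[ℝ] ℝ := (EuclideanSpace.proj a).comp (ContinuousLinearMap.fst ℝ _ _)
  have h2 : HasFDerivAt (fun w : Model n => w.1 a) L w := L.hasFDerivAt
  have hd : DifferentiableAt ℝ (fun w : Model n => φ' (‖w.1‖ ^ 2)) w :=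
    (h'.comp_hasFDerivAt w (hasFDerivAt_fst (𝕜 := ℝ) (p := w)).norm_sq).differentiableAt
  rw [h1, ((h2.const_mul 2).fun_mul hd.hasFDerivAt).fderiv]
  simp only [add_apply, smul_apply, fderiv_radial_inl h', smul_eq_mul]
  have h3 : L (planeTorusBasis n (Sum.inl a)) = 1 := by
    simp [L, planeTorusBasis_inl]
  rw [h3]
  ring

theorem sum_fderiv_radial_sq {φ : ℝ → ℝ} {φ' : ℝ} {w : Model n}
    (h : HasDerivAt φ φ' (‖w.1‖ ^ 2)) :
    ∑ a, fderiv ℝ (fun w : Model n => φ (‖w.1‖ ^ 2)) w (planeTorusBasis n (Sum.inl a)) ^ 2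
      = 4 * ‖w.1‖ ^ 2 * φ' ^ 2 := by
  simp only [fderiv_radial_inl h]
  rw [EuclideanSpace.norm_sq_eq]
  simp
  ring

theorem sum_fderiv_fderiv_radial {φ φ' : ℝ → ℝ} {φ'' : ℝ} {w : Model n}
    (h : ∀ s, 0 ≤ s → HasDerivAt φ (φ' s) s) (h' : HasDerivAt φ' φ'' (‖w.1‖ ^ 2)) :
    ∑ a, fderiv ℝ (fun z : Model n => fderiv ℝ (fun w : Model n => φ (‖w.1‖ ^ 2)) z
        (planeTorusBasis n (Sum.inl a))) w (planeTorusBasis n (Sum.inl a))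
      = 4 * φ' (‖w.1‖ ^ 2) + 4 * ‖w.1‖ ^ 2 * φ'' := by
  simp only [fderiv_fderiv_radial_inl h h']
  rw [EuclideanSpace.norm_sq_eq]
  simp
  ring

/-- The scalar curvature of a metric `exp (2 u) |dx|² + exp (2 v) |dt|²` for radial functions
`u = f(|x|²)` and `v = h(|x|²)`. -/
theorem scalarCurvature_radial {f f' f'' h h' h'' : ℝ → ℝ}
    (hf : ContDiff ℝ ∞ fun x : EuclideanSpace ℝ (Fin 2) => f (‖x‖ ^ 2))
    (hh : ContDiff ℝ ∞ fun x : EuclideanSpace ℝ (Fin 2) => h (‖x‖ ^ 2))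
    (hf' : ∀ s, 0 ≤ s → HasDerivAt f (f' s) s) (hf'' : ∀ s, 0 ≤ s → HasDerivAt f' (f'' s) s)
    (hh' : ∀ s, 0 ≤ s → HasDerivAt h (h' s) s) (hh'' : ∀ s, 0 ≤ s → HasDerivAt h' (h'' s) s)
    (p : PlaneTorus n) :
    RiemMetric.scalarCurvature (planeTorusBasis n) (blockMetric n _ _ hf hh) p
      = -(4 * Real.exp (-(2 * f (‖p.1‖ ^ 2))) *
        (2 * (f' (‖p.1‖ ^ 2) + ‖p.1‖ ^ 2 * f'' (‖p.1‖ ^ 2))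
        + 2 * (n - 2 : ℕ) * (h' (‖p.1‖ ^ 2) + ‖p.1‖ ^ 2 * h'' (‖p.1‖ ^ 2))
        + (n - 2 : ℕ) * ((n - 2 : ℕ) + 1) * (‖p.1‖ ^ 2 * h' (‖p.1‖ ^ 2) ^ 2))) := by
  have hs : (0 : ℝ) ≤ ‖p.1‖ ^ 2 := by positivity
  have hp : (extChartAt (planeTorusModel n) p p).1 = p.1 := rfl
  have hfst : ContDiff ℝ 2 (Prod.fst : Model n → EuclideanSpace ℝ (Fin 2)) := contDiff_fst
  rw [RiemMetric.scalarCurvature_of_diagonal (u := fun w : Model n => f (‖w.1‖ ^ 2))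
    (v := fun w : Model n => h (‖w.1‖ ^ 2))
    ((hf.of_le ENat.LEInfty.out).comp hfst)
    ((hh.of_le ENat.LEInfty.out).comp hfst)
    (fun y μ => fderiv_radial_inr (hf' _ (by positivity)) μ)
    (fun y μ => fderiv_radial_inr (hh' _ (by positivity)) μ)
    (Eventually.of_forall fun z => coordMatrix_blockMetric _ _ hf hh p z) _ _ _ _
    (fun _ => rfl) (fun _ => rfl) (fun _ => rfl) (fun _ => rfl)]
  rw [sum_fderiv_fderiv_radial hf' (hf'' _ (by rw [hp]; exact hs)),
    sum_fderiv_fderiv_radial hh' (hh'' _ (by rw [hp]; exact hs)),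
    sum_fderiv_radial_sq (hh' _ (by rw [hp]; exact hs)), hp, Fintype.card_fin]
  ring

end PlaneTorusMetric

/-! ### The profile functions -/

namespace PlaneTorusMetric

/-- The function `P(s) = 3 + log (1 + s)` of `s = |x|²`. It grows like twice the distance to the
origin in the cigar metric `|dx|² / (1 + |x|²)`; any constant larger than `2` would do in place
of `3`. -/
noncomputable def growth (s : ℝ) : ℝ := 3 + Real.log (1 + s)

/-- The logarithm `v = log P / k` of the length of the torus directions. -/
noncomputable def torusExponent (k s : ℝ) : ℝ := Real.log (growth s) / k

/-- The logarithm `u = v - log (1 + s) / 2` of the conformal factor in the plane directions. -/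
noncomputable def planeExponent (k s : ℝ) : ℝ := torusExponent k s - Real.log (1 + s) / 2

/-- The function `ψ = k / (2 (k + 1)) * P ^ ((k + 1) / k)`, a smooth substitute for the distance to
the origin, written with `P ^ (1 / k) = exp v`. -/
noncomputable def distanceProfile (k s : ℝ) : ℝ :=
  k / (2 * (k + 1)) * (growth s * Real.exp (torusExponent k s))

variable {k s : ℝ}

theorem three_le_growth (hs : 0 ≤ s) : 3 ≤ growth s :=
  le_add_of_nonneg_right (Real.log_nonneg (by linarith))

theorem torusExponent_nonneg (hk : 0 < k) (hs : 0 ≤ s) : 0 ≤ torusExponent k s :=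
  div_nonneg (Real.log_nonneg (by linarith [three_le_growth hs])) hk.le

theorem exp_neg_two_planeExponent (hs : 0 ≤ s) :
    Real.exp (-(2 * planeExponent k s)) = (1 + s) / Real.exp (torusExponent k s) ^ 2 := by
  have h : -(2 * planeExponent k s)
      = Real.log (1 + s) - (torusExponent k s + torusExponent k s) := by
    rw [planeExponent]; ring
  rw [h, Real.exp_sub, Real.exp_log (by linarith), Real.exp_add, sq]

theorem exp_two_planeExponent (hs : 0 ≤ s) :
    Real.exp (2 * planeExponent k s) = Real.exp (torusExponent k s) ^ 2 / (1 + s) := by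
  rw [← neg_neg (2 * planeExponent k s), Real.exp_neg, exp_neg_two_planeExponent hs, inv_div]

theorem hasDerivAt_log_one_add (hs : 0 ≤ s) :
    HasDerivAt (fun s : ℝ => Real.log (1 + s)) (1 / (1 + s)) s :=
  ((hasDerivAt_id s).const_add 1).log (by simp; linarith)

theorem hasDerivAt_growth (hs : 0 ≤ s) : HasDerivAt growth (1 / (1 + s)) s :=
  (hasDerivAt_log_one_add hs).const_add 3

theorem hasDerivAt_torusExponent (hs : 0 ≤ s) :
    HasDerivAt (torusExponent k) (1 / (k * ((1 + s) * growth s))) s := by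
  have h0 : growth s ≠ 0 := by linarith [three_le_growth hs]
  convert! ((hasDerivAt_growth hs).log h0).div_const k using 1
  rw [div_div, div_div, div_eq_div_iff_comm]
  ring

theorem hasDerivAt_deriv_torusExponent (hk : 0 < k) (hs : 0 ≤ s) :
    HasDerivAt (fun s => 1 / (k * ((1 + s) * growth s)))
      (-(growth s + 1) / (k * ((1 + s) * growth s) ^ 2)) s := by
  have h0 : 0 < growth s := by linarith [three_le_growth hs]
  have h1 : 0 < 1 + s := by linarith
  have h2 := ((((hasDerivAt_id s).const_add 1).mul (hasDerivAt_growth hs)).const_mul k).inv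
    (by simp; exact ⟨hk.ne', h1.ne', h0.ne'⟩)
  simp only [one_div]
  convert! h2 using 1
  simp
  field_simp
  ring

theorem hasDerivAt_planeExponent (hs : 0 ≤ s) :
    HasDerivAt (planeExponent k) (1 / (k * ((1 + s) * growth s)) - 1 / (1 + s) / 2) s :=
  (hasDerivAt_torusExponent hs).sub ((hasDerivAt_log_one_add hs).div_const 2)

theorem hasDerivAt_deriv_planeExponent (hk : 0 < k) (hs : 0 ≤ s) :
    HasDerivAt (fun s => 1 / (k * ((1 + s) * growth s)) - 1 / (1 + s) / 2)
      (-(growth s + 1) / (k * ((1 + s) * growth s) ^ 2) + 1 / (2 * (1 + s) ^ 2)) s := by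
  have h1 : 0 < 1 + s := by linarith
  have h2 := (((hasDerivAt_id s).const_add 1).inv (by simpa using h1.ne')).div_const 2
  convert! (hasDerivAt_deriv_torusExponent hk hs).sub h2 using 1
  · ext t
    simp
  · simp
    field_simp
    ring

theorem hasDerivAt_distanceProfile (hk : 0 < k) (hs : 0 ≤ s) :
    HasDerivAt (distanceProfile k) (Real.exp (torusExponent k s) / (2 * (1 + s))) s := by
  have h0 : 0 < growth s := by linarith [three_le_growth hs]
  have h1 : 0 < 1 + s := by linarith
  have hk1 : 0 < k + 1 := by linarith
  convert! ((hasDerivAt_growth hs).mul (hasDerivAt_torusExponent (k := k) hs).exp).const_mul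
    (k / (2 * (k + 1))) using 1
  field_simp

theorem tendsto_growth : Tendsto growth atTop atTop :=
  tendsto_atTop_add_const_left _ _
    (Real.tendsto_log_atTop.comp (tendsto_atTop_add_const_left _ _ tendsto_id))

theorem tendsto_distanceProfile (hk : 0 < k) : Tendsto (distanceProfile k) atTop atTop := by
  have hc : 0 < k / (2 * (k + 1)) := by positivity
  refine tendsto_atTop_mono' _ ?_ (tendsto_growth.const_mul_atTop hc)
  filter_upwards [eventually_ge_atTop 0] with s hs
  refine mul_le_mul_of_nonneg_left (le_mul_of_one_le_right ?_ ?_) hc.le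
  · linarith [three_le_growth hs]
  · exact Real.one_le_exp (torusExponent_nonneg hk hs)

theorem contDiff_log_one_add_norm_sq {F : Type*} [NormedAddCommGroup F] [InnerProductSpace ℝ F] :
    ContDiff ℝ ∞ fun x : F => Real.log (1 + ‖x‖ ^ 2) :=
  (contDiff_const.add (contDiff_norm_sq ℝ)).log fun x => by positivity

theorem contDiff_growth {F : Type*} [NormedAddCommGroup F] [InnerProductSpace ℝ F] :
    ContDiff ℝ ∞ fun x : F => growth (‖x‖ ^ 2) :=
  contDiff_const.add contDiff_log_one_add_norm_sq

theorem contDiff_torusExponent {F : Type*} [NormedAddCommGroup F] [InnerProductSpace ℝ F] (k : ℝ) :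
    ContDiff ℝ ∞ fun x : F => torusExponent k (‖x‖ ^ 2) :=
  (contDiff_growth.log fun x => by
    linarith [three_le_growth (show 0 ≤ ‖x‖ ^ 2 by positivity)]).div_const k

theorem contDiff_planeExponent {F : Type*} [NormedAddCommGroup F] [InnerProductSpace ℝ F] (k : ℝ) :
    ContDiff ℝ ∞ fun x : F => planeExponent k (‖x‖ ^ 2) :=
  (contDiff_torusExponent k).sub (contDiff_log_one_add_norm_sq.div_const 2)

theorem contDiff_distanceProfile {F : Type*} [NormedAddCommGroup F] [InnerProductSpace ℝ F]
    (k : ℝ) : ContDiff ℝ ∞ fun x : F => distanceProfile k (‖x‖ ^ 2) :=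
  contDiff_const.mul (contDiff_growth.mul (contDiff_torusExponent k).exp)

/-- The asymptotics of the profile: for `c < K`, the bound `K * s / (1 + s) / ψ²` on the scalar
curvature eventually exceeds `c` over the square of the lower bound `ψ - A` for the distance. -/
theorem eventually_div_sq_lt {c K A : ℝ} (hk : 0 < k) (hcK : c < K) :
    ∀ᶠ s in atTop, A < distanceProfile k s ∧
      c / (distanceProfile k s - A) ^ 2 < K * (s / (1 + s)) / distanceProfile k s ^ 2 := by
  have hψ := tendsto_distanceProfile hk
  have h1 : Tendsto (fun s : ℝ => s / (1 + s)) atTop (𝓝 1) := by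
    have h : Tendsto (fun s : ℝ => 1 - (1 + s)⁻¹) atTop (𝓝 (1 - 0)) :=
      tendsto_const_nhds.sub
        (tendsto_inv_atTop_zero.comp (tendsto_atTop_add_const_left _ _ tendsto_id))
    rw [sub_zero] at h
    refine h.congr' ?_
    filter_upwards [eventually_ge_atTop 0] with s hs
    field_simp
    ring
  have h2 : Tendsto (fun s => (1 - A * (distanceProfile k s)⁻¹) ^ 2) atTop (𝓝 1) := by
    have h : Tendsto (fun s => (1 - A * (distanceProfile k s)⁻¹) ^ 2) atTop
        (𝓝 ((1 - A * 0) ^ 2)) :=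
      (tendsto_const_nhds.sub ((tendsto_inv_atTop_zero.comp hψ).const_mul A)).pow 2
    simpa using h
  have h3 : Tendsto (fun s => K * (s / (1 + s)) * (1 - A * (distanceProfile k s)⁻¹) ^ 2) atTop
      (𝓝 (K * 1 * 1)) := (h1.const_mul K).mul h2
  have h4 := h3.eventually_const_lt (show c < K * 1 * 1 by linarith)
  filter_upwards [h4, hψ.eventually_gt_atTop A, hψ.eventually_gt_atTop 0] with s h4 hA h0
  refine ⟨hA, ?_⟩
  have h5 : 0 < distanceProfile k s - A := sub_pos.2 hA
  rw [div_lt_div_iff₀ (by positivity) (by positivity)]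
  have h6 : K * (s / (1 + s)) * (distanceProfile k s - A) ^ 2
      = K * (s / (1 + s)) * (1 - A * (distanceProfile k s)⁻¹) ^ 2 * distanceProfile k s ^ 2 := by
    rw [mul_assoc _ (_ ^ 2), ← mul_pow, sub_mul, mul_assoc A, inv_mul_cancel₀ h0.ne']
    ring
  rw [h6]
  exact mul_lt_mul_of_pos_right h4 (by positivity)

end PlaneTorusMetric

/-! ### The metric of positive scalar curvature -/

namespace PlaneTorusMetric

variable {n : ℕ}

/-- The metric `exp (2 v) (|dx|² / (1 + |x|²) + |dt|²)`, where
`v = log (3 + log (1 + |x|²)) / (n - 1)`. It is conformal to the product of a cigar and a flat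
torus. -/
noncomputable def cigarMetric (n : ℕ) : ContMDiffRiemannianMetric (planeTorusModel n) ∞ (Model n)
    (fun p : PlaneTorus n => TangentSpace (planeTorusModel n) p) :=
  blockMetric n _ _ (contDiff_planeExponent ((n : ℝ) - 1)) (contDiff_torusExponent ((n : ℝ) - 1))

theorem scalarCurvature_cigarMetric (hn : 3 ≤ n) (p : PlaneTorus n) :
    RiemMetric.scalarCurvature (planeTorusBasis n) (cigarMetric n) p
      = 4 / ((1 + ‖p.1‖ ^ 2) * Real.exp (torusExponent ((n : ℝ) - 1) (‖p.1‖ ^ 2)) ^ 2)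
        * (1 - 2 / growth (‖p.1‖ ^ 2)
          + (n : ℝ) / (n - 1) * (‖p.1‖ ^ 2 / growth (‖p.1‖ ^ 2) ^ 2)) := by
  have hn' : (3 : ℝ) ≤ n := by exact_mod_cast hn
  obtain ⟨k, hk⟩ : ∃ k : ℝ, k = n - 1 := ⟨_, rfl⟩
  have hk0 : 0 < k := by linarith
  have hm : ((n - 2 : ℕ) : ℝ) = k - 1 := by
    rw [Nat.cast_sub (by omega), hk]
    push_cast
    ring
  have hnk : (n : ℝ) = k + 1 := by linarith
  have hs : (0 : ℝ) ≤ ‖p.1‖ ^ 2 := by positivity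
  have hk1 : (0 : ℝ) < n - 1 := hk ▸ hk0
  rw [cigarMetric, scalarCurvature_radial _ _ (fun s hs => hasDerivAt_planeExponent hs)
    (fun s hs => hasDerivAt_deriv_planeExponent hk1 hs) (fun s hs => hasDerivAt_torusExponent hs)
    (fun s hs => hasDerivAt_deriv_torusExponent hk1 hs) p, ← hk,
    exp_neg_two_planeExponent hs, hm, hnk]
  generalize ‖p.1‖ ^ 2 = s at hs
  have h0 : 0 < growth s := by linarith [three_le_growth hs]
  have h1 : 0 < 1 + s := by linarith
  have h2 := Real.exp_pos (torusExponent k s)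
  generalize growth s = P at *
  generalize Real.exp (torusExponent k s) = e at *
  field_simp
  ring

/-- The lower bound for the scalar curvature that gives the decay constant: it drops the term
`1 - 2 / P`, which is positive because `P ≥ 3`. -/
theorem lt_scalarCurvature_cigarMetric (hn : 3 ≤ n) (p : PlaneTorus n) :
    ((n : ℝ) - 1) / n * (‖p.1‖ ^ 2 / (1 + ‖p.1‖ ^ 2))
        / distanceProfile ((n : ℝ) - 1) (‖p.1‖ ^ 2) ^ 2
      < RiemMetric.scalarCurvature (planeTorusBasis n) (cigarMetric n) p := by
  have hn' : (3 : ℝ) ≤ n := by exact_mod_cast hn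
  rw [scalarCurvature_cigarMetric hn, distanceProfile]
  obtain ⟨k, hk⟩ : ∃ k : ℝ, k = n - 1 := ⟨_, rfl⟩
  have hk0 : 0 < k := by linarith
  have hnk : (n : ℝ) = k + 1 := by linarith
  rw [← hk, hnk]
  have hs : (0 : ℝ) ≤ ‖p.1‖ ^ 2 := by positivity
  generalize ‖p.1‖ ^ 2 = s at hs
  have h3 : 3 ≤ growth s := three_le_growth hs
  have h0 : 0 < growth s := by linarith
  have h1 : 0 < 1 + s := by linarith
  have h2 := Real.exp_pos (torusExponent k s)
  generalize growth s = P at *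
  generalize Real.exp (torusExponent k s) = e at *
  have hpos : 0 < 4 / ((1 + s) * e ^ 2) * (1 - 2 / P) := by
    have : 2 / P < 1 := (div_lt_one h0).2 (by linarith)
    have : 0 < 1 - 2 / P := by linarith
    positivity
  have heq : k / (k + 1) * (s / (1 + s)) / (k / (2 * (k + 1)) * (P * e)) ^ 2
      = 4 / ((1 + s) * e ^ 2) * ((k + 1) / k * (s / P ^ 2)) := by
    field_simp
    ring
  rw [heq, mul_add]
  linarith

theorem scalarCurvature_cigarMetric_pos (hn : 3 ≤ n) (p : PlaneTorus n) :
    0 < RiemMetric.scalarCurvature (planeTorusBasis n) (cigarMetric n) p := by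
  have hn' : (3 : ℝ) ≤ n := by exact_mod_cast hn
  refine lt_of_le_of_lt ?_ (lt_scalarCurvature_cigarMetric hn p)
  have : (0 : ℝ) ≤ n - 1 := by linarith
  positivity

/-- The function `ψ` is `1`-Lipschitz: its Euclidean gradient is `x exp v / (1 + |x|²)`, whose squared
length is at most `exp (2 v) / (1 + |x|²) = exp (2 u)`. -/
theorem enorm_sub_le_riemDist_cigarMetric (hn : 3 ≤ n) (x y : PlaneTorus n) :
    ‖distanceProfile ((n : ℝ) - 1) (‖y.1‖ ^ 2) - distanceProfile ((n : ℝ) - 1) (‖x.1‖ ^ 2)‖ₑ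
      ≤ RiemMetric.riemDist (cigarMetric n) x y := by
  have hn' : (3 : ℝ) ≤ n := by exact_mod_cast hn
  have hk0 : (0 : ℝ) < n - 1 := by linarith
  have hfst : ContMDiff (planeTorusModel n) 𝓘(ℝ, EuclideanSpace ℝ (Fin 2)) 1
    (Prod.fst : PlaneTorus n → _) := contMDiff_fst
  have hψ := contDiff_distanceProfile (F := EuclideanSpace ℝ (Fin 2)) ((n : ℝ) - 1)
  refine RiemMetric.enorm_sub_le_riemDist (cigarMetric n)
    (ψ := fun p => distanceProfile ((n : ℝ) - 1) (‖p.1‖ ^ 2))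
    ((hψ.of_le ENat.LEInfty.out).contMDiff.comp hfst) (fun p => ?_) x y
  have hs : (0 : ℝ) ≤ ‖p.1‖ ^ 2 := by positivity
  have h1 := (hasDerivAt_distanceProfile hk0 hs).comp_hasFDerivAt p.1
    (hasStrictFDerivAt_norm_sq p.1).hasFDerivAt
  have h2 : HasMFDerivAt (planeTorusModel n) 𝓘(ℝ, EuclideanSpace ℝ (Fin 2))
    (Prod.fst : PlaneTorus n → _) p (ContinuousLinearMap.fst ℝ (EuclideanSpace ℝ (Fin 2))
      (EuclideanSpace ℝ (Fin (n - 2)))) := hasMFDerivAt_fst p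
  refine ⟨_, h1.hasMFDerivAt.comp p h2, fun w => ?_⟩
  refine le_of_le_of_eq ?_ (blockMetric_inner _ _ _ _ p w w).symm
  change (Real.exp (torusExponent ((n : ℝ) - 1) (‖p.1‖ ^ 2)) / (2 * (1 + ‖p.1‖ ^ 2))
    * (2 • inner ℝ p.1 (w : Model n).1)) ^ 2 ≤ _
  have hcs : inner ℝ p.1 (w : Model n).1 ^ 2 ≤ ‖p.1‖ ^ 2 * ‖(w : Model n).1‖ ^ 2 := by
    rw [← mul_pow, sq_le_sq, abs_of_nonneg (a := ‖p.1‖ * _) (by positivity)]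
    exact abs_real_inner_le_norm _ _
  rw [exp_two_planeExponent hs, real_inner_self_eq_norm_sq, real_inner_self_eq_norm_sq]
  refine le_add_of_le_of_nonneg ?_ (by positivity)
  have hr : 0 ≤ ‖(w : Model n).1‖ ^ 2 := by positivity
  generalize inner ℝ p.1 (w : Model n).1 = i at *
  generalize ‖(w : Model n).1‖ ^ 2 = r at *
  generalize ‖p.1‖ ^ 2 = s at *
  generalize Real.exp (torusExponent ((n : ℝ) - 1) s) = e
  have h3 : 0 < 1 + s := by linarith
  have h4 : (e / (2 * (1 + s)) * (2 • i)) ^ 2 = e ^ 2 / (1 + s) * (i ^ 2 / (1 + s)) := by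
    rw [nsmul_eq_mul]
    field_simp
    norm_num
  rw [h4]
  refine mul_le_mul_of_nonneg_left ?_ (by positivity)
  rw [div_le_iff₀ h3]
  nlinarith

theorem isCompact_norm_sq_le (n : ℕ) (S : ℝ) : IsCompact {p : PlaneTorus n | ‖p.1‖ ^ 2 ≤ S} := by
  refine ((isCompact_closedBall (0 : EuclideanSpace ℝ (Fin 2)) √S).prod
    (isCompact_univ (X := UnitAddTorus (Fin (n - 2))))).of_isClosed_subset
    (isClosed_le (by fun_prop) continuous_const) fun p hp => ⟨?_, mem_univ _⟩
  rw [mem_closedBall_zero_iff]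
  exact Real.le_sqrt_of_sq_le hp

theorem isCompact_distanceProfile_le (hn : 3 ≤ n) (B : ℝ) :
    IsCompact {p : PlaneTorus n | distanceProfile ((n : ℝ) - 1) (‖p.1‖ ^ 2) ≤ B} := by
  have hn' : (3 : ℝ) ≤ n := by exact_mod_cast hn
  have hk0 : (0 : ℝ) < n - 1 := by linarith
  obtain ⟨S, hS⟩ := eventually_atTop.1 ((tendsto_distanceProfile hk0).eventually_gt_atTop B)
  have hψ := (contDiff_distanceProfile (F := EuclideanSpace ℝ (Fin 2)) ((n : ℝ) - 1)).continuous
  refine (isCompact_norm_sq_le n S).of_isClosed_subset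
    (isClosed_le (hψ.comp continuous_fst) continuous_const) fun p hp => ?_
  by_contra h
  exact absurd (hS _ (not_le.1 h).le) (not_lt.2 hp)

theorem atMostQuadraticDecay_cigarMetric (hn : 3 ≤ n) {C : ℝ} (hC0 : 0 < C)
    (hC : C < ((n : ℝ) - 1) / n)
    (x : PlaneTorus n) :
    RiemMetric.AtMostQuadraticDecay (planeTorusBasis n) (cigarMetric n) C x := by
  have hn' : (3 : ℝ) ≤ n := by exact_mod_cast hn
  have hk0 : (0 : ℝ) < n - 1 := by linarith
  obtain ⟨S, hS⟩ := eventually_atTop.1 (eventually_div_sq_lt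
    (A := distanceProfile ((n : ℝ) - 1) (‖x.1‖ ^ 2)) hk0 hC)
  obtain ⟨D, hD0, hD⟩ := RiemMetric.exists_riemDist_lt_of_isCompact (cigarMetric n) x
    (isCompact_norm_sq_le n S)
  refine ⟨D, hD0, fun y hy => ?_⟩
  have hyS : S ≤ ‖y.1‖ ^ 2 := (not_le.1 fun h => (hD y h).not_ge hy).le
  obtain ⟨hA, hlt⟩ := hS _ hyS
  refine lt_of_le_of_lt ?_ (hlt.trans (lt_scalarCurvature_cigarMetric hn y))
  -- The scalar curvature is compared with the lower bound `ψ(y) - ψ(x)` of the distance.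
  have hdist : distanceProfile ((n : ℝ) - 1) (‖y.1‖ ^ 2)
      - distanceProfile ((n : ℝ) - 1) (‖x.1‖ ^ 2)
      ≤ (RiemMetric.riemDist (cigarMetric n) x y).toReal := by
    rw [← ENNReal.ofReal_le_iff_le_toReal (RiemMetric.riemDist_lt_top _ x y).ne]
    refine le_trans ?_ (enorm_sub_le_riemDist_cigarMetric hn x y)
    rw [← ofReal_norm]
    exact ENNReal.ofReal_le_ofReal (le_abs_self _)
  have hpos := sub_pos.2 hA
  exact div_le_div_of_nonneg_left hC0.le (by positivity) (pow_le_pow_left₀ hpos.le hdist 2)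

end PlaneTorusMetric

theorem proposition1p7 (n : ℕ) (hn : 3 ≤ n) :
    ∃ g : ContMDiffRiemannianMetric (planeTorusModel n) ∞
        (EuclideanSpace ℝ (Fin 2) × EuclideanSpace ℝ (Fin (n - 2)))
        (fun p : PlaneTorus n => TangentSpace (planeTorusModel n) p),
      RiemMetric.IsCompleteMetric g ∧
      (∀ p : PlaneTorus n,
        0 < RiemMetric.scalarCurvature (planeTorusBasis n) g p) ∧
      ∀ C : ℝ, 0 < C → C < ((n : ℝ) - 1) / n →
        ∀ x : PlaneTorus n,
          RiemMetric.AtMostQuadraticDecay (planeTorusBasis n) g C x := by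
  refine ⟨PlaneTorusMetric.cigarMetric n, ?_,
    PlaneTorusMetric.scalarCurvature_cigarMetric_pos hn,
    fun C hC0 hC x => PlaneTorusMetric.atMostQuadraticDecay_cigarMetric hn hC0 hC x⟩
  exact RiemMetric.isCompleteMetric_of_isCompact_sublevel _
    (PlaneTorusMetric.enorm_sub_le_riemDist_cigarMetric hn)
    (PlaneTorusMetric.isCompact_distanceProfile_le hn)
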